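/- Let $K$ be a field, $S=K[Y_1,\dots,Y_r]$, let $I\subset S$ be an ideal generated by squarefree monomials, and let $R=S/I$, that is, $R=K[\Delta]$ is the Stanley–Reisner ring of the simplicial complex $\Delta=\{F\subseteq\{1,\dots,r\} : \prod_{k\in F}Y_k\notin I\}$. Write $y_k$ for the residue class of $Y_k$ in $R$. Let $P\subset R$ be a monomial prime ideal, i.e. a prime ideal generated by residue classes of monomials, and put $W=\{k : y_k\in P\}$, so that $P=(y_k : k\in W)$. Grade $R$ by $\deg y_k=1$ for $k\in W$ and $\deg y_k=0$ for $k\notin W$. For $i\ge 0$ let $H^i_P(R)$ be the $i$-th local cohomology module of $R$ with respect to $P$, that is, the $i$-th cohomology of the Čech complex $$0\to C^0\to C^1\to\cdots\to C^{|W|}\to 0,\qquad C^t=\bigoplus_{F\subseteq W,\ |F|=t}R_{y_F},\qquad y_F=\prod_{k\in F}y_k,$$ with the $\mathbb Z$-grading $H^i_P(R)=\bigoplus_{j\in\mathbb Z}H^i_P(R)_j$ induced by the grading of the localizations in which $a/y_F^{\,l}$ has degree $\deg a-l|F|$ for homogeneous $a\in R$. Then for every $i\ge 0$ the graded module $H^i_P(R)$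 is tame: there is an integer $j_0$ such that either $H^i_P(R)_j=0$ for all $j\le j_0$, or $H^i_P(R)_j\ne 0$ for all $j\le j_0$. -/

import Mathlib

namespace GradedCech

section Complex

variable {R : Type*} [CommRing R] {r : ℕ}

/-- The localization `R_{y_F}` at the product `y_F` of the elements `y k`, `k ∈ F`. -/
abbrev Loc (y : Fin r → R) (F : Finset (Fin r)) : Type _ :=
  Localization.Away (∏ k ∈ F, y k)

/-- The natural map `R_{y_F} → R_{y_G}` for `F ⊆ G`. -/
noncomputable def natMap (y : Fin r → R) {F G : Finset (Fin r)} (h : F ⊆ G) :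
    Loc y F →ₐ[R] Loc y G :=
  IsLocalization.liftAlgHom (M := Submonoid.powers (∏ k ∈ F, y k))
    (f := Algebra.ofId R (Loc y G)) (by
      rintro ⟨_, l, rfl⟩
      have h1 : IsUnit (algebraMap R (Loc y G) (∏ k ∈ G, y k)) :=
        IsLocalization.Away.algebraMap_isUnit _
      have h2 : IsUnit (algebraMap R (Loc y G) (∏ k ∈ F, y k)) :=
        isUnit_of_dvd_unit (map_dvd _ (Finset.prod_dvd_prod_of_subset _ _ _ h)) h1
      simpa [Algebra.ofId_apply] using h2.pow l)

/-- The subsets of `W` with exactly `t` elements. -/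
abbrev Face (W : Set (Fin r)) (t : ℕ) : Type :=
  {F : Finset (Fin r) // (∀ k ∈ F, k ∈ W) ∧ F.card = t}

/-- Removing an element from a `(t + 1)`-element subset of `W`. -/
def Face.erase {W : Set (Fin r)} {t : ℕ} (G : Face W (t + 1)) (k : {k // k ∈ G.1}) : Face W t :=
  ⟨G.1.erase k.1, fun l hl => G.2.1 l (Finset.mem_of_mem_erase hl), by
    rw [Finset.card_erase_of_mem k.2, G.2.2, Nat.add_sub_cancel]⟩

theorem Face.erase_subset {W : Set (Fin r)} {t : ℕ} (G : Face W (t + 1)) (k : {k // k ∈ G.1}) :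
    (G.erase k).1 ⊆ G.1 :=
  Finset.erase_subset _ _

/-- The module `C^t = ⨁_{F ⊆ W, |F| = t} R_{y_F}` of the Čech complex. -/
abbrev Cochain (y : Fin r → R) (W : Set (Fin r)) (t : ℕ) : Type _ :=
  (F : Face W t) → Loc y F.1

/-- The differential `C^t → C^{t+1}` of the Čech complex: its component `R_{y_F} → R_{y_G}` is
`(-1)^{s-1}` times the natural map if `F` arises from `G` by removing the `s`-th element in
increasing order, and `0` if `F` is not contained in `G`. -/
noncomputable def differential (y : Fin r → R) (W : Set (Fin r)) (t : ℕ) :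
    Cochain y W t →ₗ[R] Cochain y W (t + 1) :=
  LinearMap.pi fun G => ∑ k : {k // k ∈ G.1},
    ((-1 : R) ^ (G.1.filter (· < k.1)).card) •
      ((natMap y (G.erase_subset k)).toLinearMap ∘ₗ
        (LinearMap.proj (G.erase k) : Cochain y W t →ₗ[R] Loc y (G.erase k).1))

theorem differential_apply (y : Fin r → R) (W : Set (Fin r)) (t : ℕ) (c : Cochain y W t)
    (G : Face W (t + 1)) :
    differential y W t c G = ∑ k : {k // k ∈ G.1},
      ((-1 : R) ^ (G.1.filter (· < k.1)).card) • natMap y (G.erase_subset k) (c (G.erase k)) := by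
  simp only [differential, LinearMap.pi_apply, LinearMap.sum_apply, LinearMap.smul_apply,
    LinearMap.comp_apply, LinearMap.proj_apply, AlgHom.toLinearMap_apply]

/-- The Čech complex is a complex. -/
theorem differential_differential (y : Fin r → R) (W : Set (Fin r)) (t : ℕ) (c : Cochain y W t) :
    differential y W (t + 1) (differential y W t c) = 0 := by
  classical
  funext G
  let e : Finset (Fin r) → Loc y G.1 := fun F =>
    if h : F ⊆ G.1 ∧ (∀ k ∈ F, k ∈ W) ∧ F.card = t then natMap y h.1 (c ⟨F, h.2⟩) else 0
  let f : (Σ _ : Fin r, Fin r) → Loc y G.1 := fun p =>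
    ((-1 : R) ^ (G.1.filter (· < p.1)).card * (-1 : R) ^ ((G.1.erase p.1).filter (· < p.2)).card) •
      e ((G.1.erase p.1).erase p.2)
  have key : differential y W (t + 1) (differential y W t c) G =
      ∑ p ∈ G.1.sigma (fun k => G.1.erase k), f p := by
    rw [Finset.sum_sigma, ← Finset.sum_coe_sort G.1]
    rw [differential_apply]
    refine Finset.sum_congr rfl fun k _ => ?_
    rw [differential_apply, map_sum, Finset.smul_sum]
    refine (Finset.sum_congr rfl fun l _ => ?_).trans
      (Finset.sum_coe_sort (G.1.erase k.1) (fun l => f ⟨k.1, l⟩))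
    have hF : (G.1.erase k.1).erase l.1 ⊆ G.1 ∧
        (∀ k' ∈ (G.1.erase k.1).erase l.1, k' ∈ W) ∧ ((G.1.erase k.1).erase l.1).card = t :=
      ⟨(Finset.erase_subset _ _).trans (Finset.erase_subset _ _), ((G.erase k).erase l).2⟩
    have he : e ((G.1.erase k.1).erase l.1) = natMap y hF.1 (c ((G.erase k).erase l)) := dif_pos hF
    have hn : ∀ z : Loc y ((G.erase k).erase l).1,
        natMap y (G.erase_subset k) (natMap y ((G.erase k).erase_subset l) z) =
          natMap y hF.1 z := by
      intro z
      have : (natMap y (G.erase_subset k)).comp (natMap y ((G.erase k).erase_subset l)) =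
          natMap y (((G.erase k).erase_subset l).trans (G.erase_subset k)) :=
        IsLocalization.algHom_ext (Submonoid.powers (∏ k ∈ ((G.erase k).erase l).1, y k))
          (by ext)
      exact DFunLike.congr_fun this z
    rw [map_smul, hn, smul_smul]
    exact congrArg _ he.symm
  rw [key]
  refine Finset.sum_involution (fun p _ => ⟨p.2, p.1⟩) ?_ ?_ ?_ ?_
  · rintro ⟨k, l⟩ hp
    simp only [Finset.mem_sigma, Finset.mem_erase] at hp
    obtain ⟨hk, hlk, hl⟩ := hp
    have hs : ∀ {a b : Fin r}, a ∈ G.1 → a < b →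
        (G.1.filter (· < b)).card = ((G.1.erase a).filter (· < b)).card + 1 ∧
        ((G.1.erase b).filter (· < a)).card = (G.1.filter (· < a)).card := by
      intro a b ha hab
      constructor
      · rw [Finset.filter_erase, Finset.card_erase_add_one (by simp [ha, hab])]
      · rw [Finset.filter_erase, Finset.erase_eq_of_notMem (by simp [hab.le])]
    simp only [f]
    rw [Finset.erase_right_comm (a := l) (b := k), ← add_smul]
    rcases lt_or_gt_of_ne hlk with h | h
    · obtain ⟨h1, h2⟩ := hs hl h
      rw [h1, h2]
      convert zero_smul R _
      ring
    · obtain ⟨h1, h2⟩ := hs hk h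
      rw [h1, h2]
      convert zero_smul R _
      ring
  · rintro ⟨k, l⟩ hp _ h
    simp only [Finset.mem_sigma, Finset.mem_erase] at hp
    simp only [Sigma.mk.injEq, heq_eq_eq] at h
    exact hp.2.1 h.1
  · rintro ⟨k, l⟩ hp
    simp only [Finset.mem_sigma, Finset.mem_erase] at hp ⊢
    exact ⟨hp.2.2, hp.2.1.symm, hp.1⟩
  · rintro ⟨k, l⟩ _
    rfl

/-- The cocycles in `C^i`. -/
noncomputable def cocycles (y : Fin r → R) (W : Set (Fin r)) (i : ℕ) :
    Submodule R (Cochain y W i) :=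
  LinearMap.ker (differential y W i)

/-- The coboundaries in `C^i`: the image of `C^{i-1}`, and zero if `i = 0`. -/
noncomputable def coboundaries (y : Fin r → R) (W : Set (Fin r)) :
    (i : ℕ) → Submodule R (Cochain y W i)
  | 0 => ⊥
  | i + 1 => LinearMap.range (differential y W i)

/-- The `i`-th cohomology module of the Čech complex of the elements `y k`, `k ∈ W`. -/
abbrev Cohomology (y : Fin r → R) (W : Set (Fin r)) (i : ℕ) : Type _ :=
  cocycles y W i ⧸ (coboundaries y W i).comap (cocycles y W i).subtype

end Complex

section Grading

variable {K : Type*} [Field K] {R : Type*} [CommRing R] [Algebra K R] {r : ℕ}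

/-- For a grading `𝒜` of `R` in which the elements `y k`, `k ∈ F`, have degree one: the component
of degree `j` of `R_{y_F}`, that is, the space of all fractions `a / y_F ^ l` with `a` homogeneous
and `deg a - l * deg y_F = j`. -/
noncomputable def locDegree (𝒜 : ℕ → Submodule K R) (y : Fin r → R) (F : Finset (Fin r)) (j : ℤ) :
    Submodule K (Loc y F) :=
  Submodule.span K {z | ∃ (l d : ℕ) (a : R), a ∈ 𝒜 d ∧ (d : ℤ) - l * F.card = j ∧
    z = Localization.mk a
      (⟨(∏ k ∈ F, y k) ^ l, l, rfl⟩ : Submonoid.powers (∏ k ∈ F, y k))}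

/-- The component of degree `j` of `C^t`. -/
noncomputable def cochainDegree (𝒜 : ℕ → Submodule K R) (y : Fin r → R) (W : Set (Fin r)) (t : ℕ)
    (j : ℤ) : Submodule K (Cochain y W t) :=
  Submodule.pi Set.univ fun F => locDegree 𝒜 y F.1 j

/-- The component of degree `j` of the `i`-th Čech cohomology: the classes of the cocycles of
degree `j`. -/
noncomputable def cohomologyDegree (𝒜 : ℕ → Submodule K R) (y : Fin r → R) (W : Set (Fin r))
    (i : ℕ) (j : ℤ) : Submodule K (Cohomology y W i) :=
  ((cochainDegree 𝒜 y W i j).comap ((cocycles y W i).subtype.restrictScalars K)).map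
    (((coboundaries y W i).comap (cocycles y W i).subtype).mkQ.restrictScalars K)

end Grading

end GradedCech

/-- A family of graded components `N j` is tame if `N j` is zero for all `j ≪ 0` or nonzero for all
`j ≪ 0`. -/
def IsTame {K N : Type*} [Field K] [AddCommGroup N] [Module K N] (𝒩 : ℤ → Submodule K N) : Prop :=
  ∃ j₀ : ℤ, (∀ j ≤ j₀, 𝒩 j = ⊥) ∨ (∀ j ≤ j₀, 𝒩 j ≠ ⊥)

section Monomial

open MvPolynomial

variable {K : Type*} [Field K] {r : ℕ}

/-- An ideal of `K[Y_1, …, Y_r]` generated by squarefree monomials. -/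
def IsSquarefreeMonomialIdeal (I : Ideal (MvPolynomial (Fin r) K)) : Prop :=
  ∃ A : Set (Finset (Fin r)), I = Ideal.span ((fun F => ∏ k ∈ F, X k) '' A)

/-- An ideal of `K[Y_1, …, Y_r] / I` generated by residue classes of monomials. -/
def IsMonomialIdeal {I : Ideal (MvPolynomial (Fin r) K)} (P : Ideal (MvPolynomial (Fin r) K ⧸ I)) :
    Prop :=
  ∃ A : Set (Fin r →₀ ℕ), P = Ideal.span ((fun c => Ideal.Quotient.mk I (monomial c 1)) '' A)

/-- The residue class `y_k` of the variable `Y_k`. -/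
noncomputable def resVar (I : Ideal (MvPolynomial (Fin r) K)) (k : Fin r) :
    MvPolynomial (Fin r) K ⧸ I :=
  Ideal.Quotient.mk I (X k)

variable {I : Ideal (MvPolynomial (Fin r) K)} (P : Ideal (MvPolynomial (Fin r) K ⧸ I))

/-- The variables whose residue class lies in `P`. -/
def varsIn : Set (Fin r) := {k | resVar I k ∈ P}

/-- A monomial prime ideal `P` is generated by the residue classes of variables that lie in it. -/
theorem span_varsIn (hmon : IsMonomialIdeal P) (hprime : P.IsPrime) :
    Ideal.span (resVar I '' varsIn P) = P := by
  obtain ⟨A, hA⟩ := hmon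
  refine le_antisymm (Ideal.span_le.2 ?_) ?_
  · rintro _ ⟨k, hk, rfl⟩
    exact hk
  · conv_lhs => rw [hA]
    refine Ideal.span_le.2 ?_
    rintro _ ⟨c, hc, rfl⟩
    have hP : Ideal.Quotient.mk I (monomial c 1) ∈ P := by
      rw [hA]
      exact Ideal.subset_span ⟨c, hc, rfl⟩
    have hmk : Ideal.Quotient.mk I (monomial c 1) = ∏ k ∈ c.support, resVar I k ^ c k := by
      rw [monomial_eq, map_one, one_mul, Finsupp.prod, map_prod]
      simp only [map_pow, resVar]
    simp only [hmk] at hP ⊢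
    obtain ⟨k, hk, hkP⟩ := hprime.prod_mem_iff.1 hP
    have hv : resVar I k ∈ Ideal.span (resVar I '' varsIn P) :=
      Ideal.subset_span ⟨k, hprime.mem_of_pow_mem _ hkP, rfl⟩
    exact Ideal.mem_of_dvd _ (Finset.dvd_prod_of_mem _ hk)
      (Ideal.pow_mem_of_mem _ hv _ (Nat.pos_of_ne_zero (Finsupp.mem_support_iff.1 hk)))

/-- The grading of `R = K[Y_1, …, Y_r] / I` in which the `y_k ∈ P` have degree one and the other
`y_k` have degree zero. -/
noncomputable def ringDegree (d : ℕ) : Submodule K (MvPolynomial (Fin r) K ⧸ I) :=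
  (weightedHomogeneousSubmodule K ((varsIn P).indicator (1 : Fin r → ℕ)) d).map
    (Ideal.Quotient.mkₐ K I).toLinearMap

/-- The `i`-th local cohomology module `H^i_P(R)` of `R = K[Y_1, …, Y_r] / I` with respect to a
monomial prime ideal `P`, as the cohomology of the Čech complex of the `y_k ∈ P`. -/
abbrev LocalCohomologyAt (i : ℕ) : Type _ :=
  GradedCech.Cohomology (resVar I) (varsIn P) i

/-- The component `H^i_P(R)_j`, for the grading of `R` in which the `y_k ∈ P` have degree one and
the other `y_k` have degree zero. -/
noncomputable def localCohomologyDegree (i : ℕ) (j : ℤ) : Submodule K (LocalCohomologyAt P i) :=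
  GradedCech.cohomologyDegree (ringDegree P) (resVar I) (varsIn P) i j

end Monomial

/-!
The localizations `R_{y_F}` and the natural maps between them are graded by the degree in each
single variable `Y_k`, because `I` is generated by monomials. Let `π_k` be the projection of
`R_{y_F}` onto its part of negative `Y_k`-degree. This part is zero if `k ∉ F`, and if `k ∈ F` then
`y_k` is a unit of `R_{y_F}`. So `z ↦ y_k⁻¹ π_k z` is defined on all of the Čech complex. It is a
chain map that lowers the degree by one (`negDiv`), and multiplying it by `y_k` gives `π_k`.

Suppose that `H^i_P(R)_{j-1} = 0` and let `c` be a cocycle of degree `j < 0`. Then `y_k⁻¹ π_k c` is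
a coboundary for every `k`, hence so is `π_k c` (`negDegPart_mem_coboundaries`), and therefore
`c` agrees modulo coboundaries with `(∏_k (1 - π_k)) c`. This element is zero: a monomial fraction
whose total degree in the `y_k`, `k ∈ W`, is negative has negative degree in one of them
(`nonnegDegPart_eq_zero`). Hence `H^i_P(R)_j = 0` (`localCohomologyDegree_eq_bot`). Contrapositively,
if `H^i_P(R)` is nonzero in one negative degree, then it is nonzero in all smaller degrees.

The projection `π_k` is read off from the homomorphism `R_{y_F} → R_{y_F}[T, T⁻¹]` with
`y_k ↦ y_k T` and `y_l ↦ y_l` for `l ≠ k`, which exists by the universal properties of the quotient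
and the localization. Identities between `K`-linear maps are checked on the monomial fractions
`y^c / y_F ^ l`, which span `R_{y_F}`.
-/

open GradedCech MvPolynomial

/-! ### Monomial fractions -/

section MonomialFractions

variable {K : Type*} [Field K] {r : ℕ} {I : Ideal (MvPolynomial (Fin r) K)}

/-- The fraction `y^c / y_F ^ l` in `R_{y_F}`, for `R = K[Y_1, …, Y_r] / I`. -/
noncomputable def monFrac (I : Ideal (MvPolynomial (Fin r) K)) (F : Finset (Fin r))
    (c : Fin r →₀ ℕ) (l : ℕ) : Loc (resVar I) F :=
  Localization.mk (Ideal.Quotient.mk I (monomial c 1))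
    (⟨(∏ k ∈ F, resVar I k) ^ l, l, rfl⟩ : Submonoid.powers (∏ k ∈ F, resVar I k))

theorem isUnit_algebraMap_prod (F : Finset (Fin r)) :
    IsUnit (algebraMap _ (Loc (resVar I) F) (∏ k ∈ F, resVar I k)) :=
  IsLocalization.Away.algebraMap_isUnit _

theorem isUnit_algebraMap_resVar {F : Finset (Fin r)} {k : Fin r} (hk : k ∈ F) :
    IsUnit (algebraMap _ (Loc (resVar I) F) (resVar I k)) :=
  isUnit_of_dvd_unit (map_dvd _ (Finset.dvd_prod_of_mem _ hk)) (isUnit_algebraMap_prod F)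

theorem eq_monFrac_iff {F : Finset (Fin r)} {c : Fin r →₀ ℕ} {l : ℕ} {z : Loc (resVar I) F} :
    z = monFrac I F c l ↔
      z * algebraMap _ _ (∏ k ∈ F, resVar I k) ^ l =
        algebraMap _ _ (Ideal.Quotient.mk I (monomial c 1)) := by
  rw [monFrac, Localization.mk_eq_mk', eq_comm, IsLocalization.mk'_eq_iff_eq_mul, map_pow, eq_comm]

theorem monFrac_mul (F : Finset (Fin r)) (c : Fin r →₀ ℕ) (l : ℕ) :
    monFrac I F c l * algebraMap _ _ (∏ k ∈ F, resVar I k) ^ l =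
      algebraMap _ _ (Ideal.Quotient.mk I (monomial c 1)) :=
  eq_monFrac_iff.1 rfl

theorem mk_eq_smul_monFrac (F : Finset (Fin r)) (c : Fin r →₀ ℕ) (a : K) (l : ℕ) :
    Localization.mk (Ideal.Quotient.mk I (monomial c a))
      (⟨(∏ k ∈ F, resVar I k) ^ l, l, rfl⟩ : Submonoid.powers (∏ k ∈ F, resVar I k)) =
      a • monFrac I F c l := by
  have : Ideal.Quotient.mk I (monomial c a) = a • Ideal.Quotient.mk I (monomial c 1) := by
    rw [← mul_one a, ← smul_eq_mul, ← smul_monomial, smul_eq_mul, mul_one]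
    exact map_smul (Ideal.Quotient.mkₐ K I) a _
  rw [this, ← Localization.smul_mk]
  rfl

theorem mk_monomial_indicator (G : Finset (Fin r)) :
    Ideal.Quotient.mk I (monomial (∑ k ∈ G, Finsupp.single k 1) 1) = ∏ k ∈ G, resVar I k := by
  rw [monomial_sum_one, map_prod]
  rfl

theorem mk_monomial_add (c c' : Fin r →₀ ℕ) :
    Ideal.Quotient.mk I (monomial (c + c') 1) =
      Ideal.Quotient.mk I (monomial c 1) * Ideal.Quotient.mk I (monomial c' 1) := by
  rw [← map_mul, monomial_mul, one_mul]

/-- The natural map `R_{y_F} → R_{y_G}` expands `y^c / y_F ^ l` by `y_{G \ F} ^ l`. -/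
theorem natMap_monFrac {F G : Finset (Fin r)} (h : F ⊆ G) (c : Fin r →₀ ℕ) (l : ℕ) :
    natMap (resVar I) h (monFrac I F c l) =
      monFrac I G (c + l • ∑ k ∈ G \ F, Finsupp.single k 1) l := by
  have hG : algebraMap _ (Loc (resVar I) G) (∏ k ∈ G, resVar I k) =
      natMap (resVar I) h (algebraMap _ _ (∏ k ∈ F, resVar I k)) *
        algebraMap _ _ (Ideal.Quotient.mk I (monomial (∑ k ∈ G \ F, Finsupp.single k 1) 1)) := by
    rw [mk_monomial_indicator, AlgHom.commutes, ← map_mul, mul_comm, Finset.prod_sdiff h]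
  rw [eq_monFrac_iff, hG, mul_pow, ← mul_assoc, ← map_pow, ← map_mul, monFrac_mul,
    AlgHom.commutes, ← map_pow, ← map_mul, mk_monomial_add, ← map_pow,
    monomial_pow, one_pow]

theorem span_monFrac (F : Finset (Fin r)) :
    Submodule.span K (Set.range fun p : (Fin r →₀ ℕ) × ℕ => monFrac I F p.1 p.2) = ⊤ := by
  refine eq_top_iff.2 fun z _ => ?_
  induction z using Localization.induction_on with
  | H p =>
    obtain ⟨a, _, l, rfl⟩ := p
    obtain ⟨a, rfl⟩ := Ideal.Quotient.mk_surjective a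
    induction a using MvPolynomial.induction_on' with
    | monomial c a =>
      rw [mk_eq_smul_monFrac]
      exact Submodule.smul_mem _ _ (Submodule.subset_span ⟨(c, l), rfl⟩)
    | add p q hp hq =>
      rw [map_add, ← Localization.add_mk_self]
      exact add_mem (hp trivial) (hq trivial)

/-- A `K`-linear identity in `R_{y_F}` may be checked on monomial fractions. -/
theorem linearMap_ext_monFrac {F : Finset (Fin r)} {M : Type*} [AddCommGroup M] [Module K M]
    {f g : Loc (resVar I) F →ₗ[K] M} (h : ∀ c l, f (monFrac I F c l) = g (monFrac I F c l)) :
    f = g := by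
  refine LinearMap.ext_on (span_monFrac F) ?_
  rintro _ ⟨p, rfl⟩
  exact h _ _

/-- The component of degree `j` of `R_{y_F}` is spanned by the monomial fractions in it, since the
homogeneous elements of `R` are sums of residue classes of monomials of the same degree. -/
theorem locDegree_ringDegree (P : Ideal (MvPolynomial (Fin r) K ⧸ I)) (F : Finset (Fin r)) (j : ℤ) :
    locDegree (ringDegree P) (resVar I) F j =
      Submodule.span K {z | ∃ (c : Fin r →₀ ℕ) (l : ℕ),
        (Finsupp.weight ((varsIn P).indicator (1 : Fin r → ℕ)) c : ℤ) - l * F.card = j ∧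
          z = monFrac I F c l} := by
  refine le_antisymm (Submodule.span_le.2 ?_) (Submodule.span_mono ?_)
  · rintro _ ⟨l, d, _, ⟨p, hp, rfl⟩, hj, rfl⟩
    have hp' : IsWeightedHomogeneous ((varsIn P).indicator (1 : Fin r → ℕ)) p d := hp
    have : ∀ p : MvPolynomial (Fin r) K, Localization.mk (Ideal.Quotient.mk I p)
        (⟨(∏ k ∈ F, resVar I k) ^ l, l, rfl⟩ : Submonoid.powers (∏ k ∈ F, resVar I k)) =
        ∑ c ∈ p.support, p.coeff c • monFrac I F c l := by
      intro p
      conv_lhs => rw [← support_sum_monomial_coeff p, map_sum, Localization.mk_sum]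
      exact Finset.sum_congr rfl fun c _ => mk_eq_smul_monFrac ..
    refine (this p).symm ▸ Submodule.sum_mem _ fun c hc => Submodule.smul_mem _ _
      (Submodule.subset_span ⟨c, l, ?_, rfl⟩)
    rw [hp' (mem_support_iff.1 hc), hj]
  · rintro _ ⟨c, l, hj, rfl⟩
    exact ⟨l, _, _, ⟨_, isWeightedHomogeneous_monomial _ c 1 rfl, rfl⟩, hj, rfl⟩

end MonomialFractions

/-! ### The part of negative degree in one variable -/

section NegativePart

variable {K : Type*} [Field K] {r : ℕ} {I : Ideal (MvPolynomial (Fin r) K)}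

/-- The homomorphism `K[Y_1, …, Y_r] → R_{y_F}[T, T⁻¹]` with `Y_k ↦ y_k T` and `Y_l ↦ y_l` for
`l ≠ k`. -/
noncomputable def polyCoaction (I : Ideal (MvPolynomial (Fin r) K)) (k : Fin r)
    (F : Finset (Fin r)) : MvPolynomial (Fin r) K →ₐ[K] LaurentPolynomial (Loc (resVar I) F) :=
  aeval fun l => AddMonoidAlgebra.single (if l = k then 1 else 0) (algebraMap _ _ (resVar I l))

theorem polyCoaction_monomial (k : Fin r) (F : Finset (Fin r)) (c : Fin r →₀ ℕ) :
    polyCoaction I k F (monomial c 1) =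
      AddMonoidAlgebra.single (c k : ℤ)
        (algebraMap _ _ (Ideal.Quotient.mk I (monomial c 1))) := by
  induction c using Finsupp.induction_linear with
  | zero => rw [← one_def, map_one, map_one, map_one]; rfl
  | add c c' hc hc' =>
    rw [mk_monomial_add, ← one_mul (1 : K), ← monomial_mul, map_mul, one_mul, hc, hc',
      AddMonoidAlgebra.single_mul_single, map_mul, Finsupp.add_apply, Nat.cast_add]
  | single l n =>
    rw [← X_pow_eq_monomial, map_pow, map_pow, polyCoaction, aeval_X,
      AddMonoidAlgebra.single_pow, map_pow]
    congr 1
    by_cases h : l = k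
    · simp [h]
    · simp [h]

/-- Squarefree monomials, like all monomials, are homogeneous in `Y_k`, so the coaction is defined
on `R`. -/
theorem polyCoaction_eq_zero (hI : IsSquarefreeMonomialIdeal I) (k : Fin r) (F : Finset (Fin r))
    {p : MvPolynomial (Fin r) K} (hp : p ∈ I) : polyCoaction I k F p = 0 := by
  suffices h : I ≤ RingHom.ker (polyCoaction I k F) from h hp
  obtain ⟨A, hA⟩ := hI
  -- `I` also occurs in the type of the coaction, so only its occurrence on the left is rewritten
  conv_lhs => rw [hA]
  refine Ideal.span_le.2 ?_
  rintro _ ⟨G, hG, rfl⟩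
  have hm : Ideal.Quotient.mk I (∏ l ∈ G, X l) = 0 := by
    exact Ideal.Quotient.eq_zero_iff_mem.2 (hA.ge (Ideal.subset_span ⟨G, hG, rfl⟩))
  have hX : (∏ l ∈ G, X l : MvPolynomial (Fin r) K) =
      monomial (∑ l ∈ G, Finsupp.single l 1) 1 := (monomial_sum_one ..).symm
  rw [hX] at hm
  change polyCoaction I k F (∏ l ∈ G, X l) = 0
  rw [hX, polyCoaction_monomial, hm, map_zero, AddMonoidAlgebra.single_zero]

/-- The homomorphism `R → R_{y_F}[T, T⁻¹]` with `y_k ↦ y_k T` and `y_l ↦ y_l` for `l ≠ k`. -/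
noncomputable def quotCoaction (hI : IsSquarefreeMonomialIdeal I) (k : Fin r)
    (F : Finset (Fin r)) :
    MvPolynomial (Fin r) K ⧸ I →ₐ[K] LaurentPolynomial (Loc (resVar I) F) :=
  Ideal.Quotient.liftₐ I (polyCoaction I k F) fun _ => polyCoaction_eq_zero hI k F

theorem quotCoaction_monomial (hI : IsSquarefreeMonomialIdeal I) (k : Fin r) (F : Finset (Fin r))
    (c : Fin r →₀ ℕ) :
    quotCoaction hI k F (Ideal.Quotient.mk I (monomial c 1)) =
      AddMonoidAlgebra.single (c k : ℤ)
        (algebraMap _ _ (Ideal.Quotient.mk I (monomial c 1))) :=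
  polyCoaction_monomial k F c

theorem quotCoaction_prod (hI : IsSquarefreeMonomialIdeal I) (k : Fin r) (F : Finset (Fin r)) :
    quotCoaction hI k F (∏ l ∈ F, resVar I l) =
      AddMonoidAlgebra.single (if k ∈ F then 1 else 0) (algebraMap _ _ (∏ l ∈ F, resVar I l)) := by
  have h := quotCoaction_monomial hI k F (∑ l ∈ F, Finsupp.single l 1)
  rw [mk_monomial_indicator] at h
  rw [h]
  congr 1
  simp [Finsupp.finsetSum_apply, Finsupp.single_apply]

/-- The homomorphism `R_{y_F} → R_{y_F}[T, T⁻¹]` with `y_k ↦ y_k T` and `y_l ↦ y_l` for `l ≠ k`: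
the coefficient of `T ^ n` in the image of `z` is the component of `z` of degree `n` in `y_k`. -/
noncomputable def locCoaction (hI : IsSquarefreeMonomialIdeal I) (k : Fin r)
    (F : Finset (Fin r)) : Loc (resVar I) F →ₐ[K] LaurentPolynomial (Loc (resVar I) F) :=
  IsLocalization.liftAlgHom (M := Submonoid.powers (∏ l ∈ F, resVar I l))
    (f := quotCoaction hI k F) (by
      rintro ⟨_, l, rfl⟩
      have h : IsUnit (quotCoaction hI k F (∏ l ∈ F, resVar I l)) := by
        rw [quotCoaction_prod, LaurentPolynomial.single_eq_C_mul_T]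
        exact ((isUnit_algebraMap_prod F).map LaurentPolynomial.C).mul
          (LaurentPolynomial.isUnit_T _)
      simpa using h.pow l)

theorem locCoaction_algebraMap (hI : IsSquarefreeMonomialIdeal I) (k : Fin r)
    (F : Finset (Fin r)) (a : MvPolynomial (Fin r) K ⧸ I) :
    locCoaction hI k F (algebraMap _ _ a) = quotCoaction hI k F a :=
  IsLocalization.lift_eq _ _

theorem locCoaction_monFrac (hI : IsSquarefreeMonomialIdeal I) (k : Fin r) (F : Finset (Fin r))
    (c : Fin r →₀ ℕ) (l : ℕ) :
    locCoaction hI k F (monFrac I F c l) =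
      AddMonoidAlgebra.single ((c k : ℤ) - if k ∈ F then (l : ℤ) else 0) (monFrac I F c l) := by
  -- the denominator has a unit as its image, so the claim is the one for the numerator
  have hu : IsUnit (locCoaction hI k F (algebraMap _ _ (∏ k ∈ F, resVar I k) ^ l)) :=
    ((isUnit_algebraMap_prod F).pow l).map _
  rw [← hu.mul_left_inj, ← map_mul, monFrac_mul, locCoaction_algebraMap, quotCoaction_monomial,
    map_pow, locCoaction_algebraMap, quotCoaction_prod, AddMonoidAlgebra.single_pow,
    AddMonoidAlgebra.single_mul_single, monFrac_mul]
  congr 1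
  split_ifs <;> simp

/-- The projection of `R_{y_F}` onto its part of negative degree in `y_k`. -/
noncomputable def negDegPart (hI : IsSquarefreeMonomialIdeal I) (k : Fin r) (F : Finset (Fin r)) :
    Loc (resVar I) F →ₗ[K] Loc (resVar I) F :=
  (Finsupp.lsum K fun n : ℤ => if n < 0 then LinearMap.id else 0) ∘ₗ
    (AddMonoidAlgebra.coeffLinearEquiv K).toLinearMap ∘ₗ (locCoaction hI k F).toLinearMap

theorem negDegPart_monFrac (hI : IsSquarefreeMonomialIdeal I) (k : Fin r) (F : Finset (Fin r))
    (c : Fin r →₀ ℕ) (l : ℕ) :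
    negDegPart hI k F (monFrac I F c l) = if k ∈ F ∧ c k < l then monFrac I F c l else 0 := by
  have h : (c k : ℤ) - (if k ∈ F then (l : ℤ) else 0) < 0 ↔ k ∈ F ∧ c k < l := by
    split_ifs with hk <;> simp [hk]
  have : negDegPart hI k F (monFrac I F c l) =
      (Finsupp.lsum K fun n : ℤ => if n < 0 then LinearMap.id else 0)
        (locCoaction hI k F (monFrac I F c l)).coeff := rfl
  rw [this, locCoaction_monFrac, AddMonoidAlgebra.coeff_single, Finsupp.lsum_single]
  simp only [h]
  split_ifs <;> rfl

theorem negDegPart_of_notMem (hI : IsSquarefreeMonomialIdeal I) {k : Fin r} {F : Finset (Fin r)}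
    (hk : k ∉ F) : negDegPart hI k F = 0 :=
  linearMap_ext_monFrac fun c l => by simp [negDegPart_monFrac, hk]

theorem natMap_negDegPart (hI : IsSquarefreeMonomialIdeal I) (k : Fin r) {F G : Finset (Fin r)}
    (h : F ⊆ G) (z : Loc (resVar I) F) :
    natMap (resVar I) h (negDegPart hI k F z) = negDegPart hI k G (natMap (resVar I) h z) := by
  have : ((natMap (resVar I) h).toLinearMap.restrictScalars K) ∘ₗ negDegPart hI k F =
      negDegPart hI k G ∘ₗ ((natMap (resVar I) h).toLinearMap.restrictScalars K) := by
    refine linearMap_ext_monFrac fun c l => ?_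
    change natMap (resVar I) h (negDegPart hI k F (monFrac I F c l)) =
      negDegPart hI k G (natMap (resVar I) h (monFrac I F c l))
    rw [negDegPart_monFrac, natMap_monFrac, negDegPart_monFrac, apply_ite (natMap (resVar I) h),
      map_zero, natMap_monFrac]
    congr 1
    by_cases hF : k ∈ F
    · simp [hF, h hF, Finsupp.single_apply]
    · by_cases hG : k ∈ G <;> simp [hF, hG, Finsupp.single_apply]
  exact LinearMap.congr_fun this z

/-! ### Division by a variable on the negative part -/

/-- Division by `y_k` on the part of `R_{y_F}` of negative degree in `y_k`, and zero on the other
part. If `y_k` is not a unit of `R_{y_F}`, then `Ring.inverse` takes the value zero; this does no harm,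
since `k ∉ F` in this case and the negative part is zero. -/
noncomputable def negDiv (hI : IsSquarefreeMonomialIdeal I) (k : Fin r) (F : Finset (Fin r)) :
    Loc (resVar I) F →ₗ[K] Loc (resVar I) F :=
  LinearMap.mulLeft K (Ring.inverse (algebraMap _ _ (resVar I k))) ∘ₗ negDegPart hI k F

theorem negDiv_apply (hI : IsSquarefreeMonomialIdeal I) (k : Fin r) (F : Finset (Fin r))
    (z : Loc (resVar I) F) :
    negDiv hI k F z = Ring.inverse (algebraMap _ _ (resVar I k)) * negDegPart hI k F z := rfl

/-- Multiplication by `y_k` turns the division by `y_k` into the projection onto the negative part.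
This holds for `k ∉ F` as well, where both sides are zero. -/
theorem resVar_smul_negDiv (hI : IsSquarefreeMonomialIdeal I) (k : Fin r) (F : Finset (Fin r))
    (z : Loc (resVar I) F) : resVar I k • negDiv hI k F z = negDegPart hI k F z := by
  by_cases hk : k ∈ F
  · rw [negDiv_apply]
    refine (Algebra.smul_def (resVar I k) (_ : Loc (resVar I) F)).trans ?_
    rw [← mul_assoc, Ring.mul_inverse_cancel _ (isUnit_algebraMap_resVar hk), one_mul]
  · simp [negDiv_apply, negDegPart_of_notMem hI hk]

theorem natMap_negDiv (hI : IsSquarefreeMonomialIdeal I) (k : Fin r) {F G : Finset (Fin r)}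
    (h : F ⊆ G) (z : Loc (resVar I) F) :
    natMap (resVar I) h (negDiv hI k F z) = negDiv hI k G (natMap (resVar I) h z) := by
  by_cases hk : k ∈ F
  · have hu := isUnit_algebraMap_resVar (I := I) (h hk)
    refine hu.mul_right_inj.1 ((Algebra.smul_def _ _).symm.trans
      (Eq.trans ?_ (Algebra.smul_def _ _)))
    rw [resVar_smul_negDiv, ← map_smul, resVar_smul_negDiv, natMap_negDegPart]
  · rw [negDiv_apply, negDiv_apply, ← natMap_negDegPart, negDegPart_of_notMem hI hk]
    simp

theorem negDiv_monFrac (hI : IsSquarefreeMonomialIdeal I) {k : Fin r} {F : Finset (Fin r)}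
    (hk : k ∈ F) (c : Fin r →₀ ℕ) (l : ℕ) :
    negDiv hI k F (monFrac I F c l) =
      if c k < l then monFrac I F (c + ∑ m ∈ F.erase k, Finsupp.single m 1) (l + 1) else 0 := by
  rw [negDiv_apply, negDegPart_monFrac]
  simp only [hk, true_and]
  split_ifs
  · -- `y_k⁻¹ = y_{F \ {k}} / y_F`
    have hF : algebraMap _ (Loc (resVar I) F) (∏ m ∈ F, resVar I m) = algebraMap _ _ (resVar I k) *
        algebraMap _ _ (Ideal.Quotient.mk I (monomial (∑ m ∈ F.erase k, Finsupp.single m 1) 1)) := by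
      rw [mk_monomial_indicator, ← map_mul, Finset.mul_prod_erase F _ hk]
    have hu := Ring.inverse_mul_cancel _ (isUnit_algebraMap_resVar (I := I) hk)
    rw [eq_monFrac_iff, mk_monomial_add, map_mul, ← monFrac_mul F c l, pow_succ]
    conv_lhs => enter [2, 2]; rw [hF]
    linear_combination (monFrac I F c l * algebraMap _ _ (∏ m ∈ F, resVar I m) ^ l *
      algebraMap _ _ (Ideal.Quotient.mk I (monomial (∑ m ∈ F.erase k, Finsupp.single m 1) 1))) * hu
  · rw [mul_zero]

theorem negDiv_mem_locDegree (hI : IsSquarefreeMonomialIdeal I)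
    (P : Ideal (MvPolynomial (Fin r) K ⧸ I)) {F : Finset (Fin r)} (hF : ∀ k ∈ F, k ∈ varsIn P)
    (k : Fin r) {j : ℤ} {z : Loc (resVar I) F}
    (hz : z ∈ locDegree (ringDegree P) (resVar I) F j) :
    negDiv hI k F z ∈ locDegree (ringDegree P) (resVar I) F (j - 1) := by
  by_cases hk : k ∈ F
  · rw [locDegree_ringDegree] at hz ⊢
    refine Submodule.mem_comap.1 (SetLike.le_def.1 ?_ hz)
    refine Submodule.span_le.2 ?_
    rintro _ ⟨c, l, hj, rfl⟩
    rw [SetLike.mem_coe, Submodule.mem_comap, negDiv_monFrac hI hk]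
    split_ifs
    · -- the numerator gains the weight `|F| - 1` and the denominator the weight `|F|`
      refine Submodule.subset_span ⟨_, _, ?_, rfl⟩
      have hw : ∀ m ∈ F.erase k, (varsIn P).indicator (1 : Fin r → ℕ) m = 1 := fun m hm =>
        Set.indicator_of_mem (hF m (Finset.mem_of_mem_erase hm)) _
      have hcard := Finset.card_erase_add_one hk
      rw [map_add, map_sum]
      simp only [Finsupp.weight_single, one_smul]
      rw [Finset.sum_congr rfl hw, Finset.sum_const, smul_eq_mul, mul_one, ← hj, ← hcard]
      push_cast
      ring
    · exact zero_mem _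
  · simp [negDiv_apply, negDegPart_of_notMem hI hk]

/-! ### The part of nonnegative degree in several variables -/

/-- The product of the operators `1 - π_k` for `k` in a list, `π_k` being the projection of
`R_{y_F}` onto its part of negative degree in `y_k`: the projection onto the part of nonnegative
degree in these `y_k`. -/
noncomputable def nonnegDegPart (hI : IsSquarefreeMonomialIdeal I) (L : List (Fin r))
    (F : Finset (Fin r)) : Module.End K (Loc (resVar I) F) :=
  (L.map fun k => 1 - negDegPart hI k F).prod

theorem nonnegDegPart_nil (hI : IsSquarefreeMonomialIdeal I) (F : Finset (Fin r))
    (z : Loc (resVar I) F) : nonnegDegPart hI [] F z = z := rfl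

theorem nonnegDegPart_cons (hI : IsSquarefreeMonomialIdeal I) (k : Fin r) (L : List (Fin r))
    (F : Finset (Fin r)) (z : Loc (resVar I) F) :
    nonnegDegPart hI (k :: L) F z =
      nonnegDegPart hI L F z - negDegPart hI k F (nonnegDegPart hI L F z) := by
  simp [nonnegDegPart]

theorem nonnegDegPart_monFrac (hI : IsSquarefreeMonomialIdeal I) (L : List (Fin r))
    (F : Finset (Fin r)) (c : Fin r →₀ ℕ) (l : ℕ) :
    nonnegDegPart hI L F (monFrac I F c l) =
      if ∃ k ∈ L, k ∈ F ∧ c k < l then 0 else monFrac I F c l := by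
  induction L with
  | nil => simp [nonnegDegPart_nil]
  | cons k L ih =>
    rw [nonnegDegPart_cons, ih]
    by_cases h : ∃ k ∈ L, k ∈ F ∧ c k < l
    · simp [h]
    · simp only [h, if_false, negDegPart_monFrac, List.mem_cons, exists_eq_or_imp, or_false]
      split_ifs <;> simp

/-- A monomial fraction of negative total degree in the `y_k`, `k ∈ W`, has negative degree in one
of these `y_k`. -/
theorem nonnegDegPart_eq_zero (hI : IsSquarefreeMonomialIdeal I)
    (P : Ideal (MvPolynomial (Fin r) K ⧸ I)) {F : Finset (Fin r)} (hF : ∀ k ∈ F, k ∈ varsIn P)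
    {L : List (Fin r)} (hL : ∀ k ∈ varsIn P, k ∈ L) {j : ℤ} (hj : j < 0)
    {z : Loc (resVar I) F} (hz : z ∈ locDegree (ringDegree P) (resVar I) F j) :
    nonnegDegPart hI L F z = 0 := by
  rw [locDegree_ringDegree] at hz
  suffices h : _ ≤ LinearMap.ker (nonnegDegPart hI L F) from h hz
  refine Submodule.span_le.2 ?_
  rintro _ ⟨c, l, hc, rfl⟩
  rw [SetLike.mem_coe, LinearMap.mem_ker, nonnegDegPart_monFrac, if_pos]
  by_contra! h
  -- otherwise `l * |F| ≤ ∑ k ∈ F, c k`, so the total degree is nonnegative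
  have h1 : F.card * l ≤ ∑ k ∈ F, c k := by
    rw [← smul_eq_mul]
    exact Finset.card_nsmul_le_sum _ _ _ fun k hk => h k (hL k (hF k hk)) hk
  have h2 : ∑ k ∈ F, c k ≤ Finsupp.weight ((varsIn P).indicator (1 : Fin r → ℕ)) c := by
    rw [Finsupp.weight_apply, Finsupp.sum_fintype _ _ (by simp)]
    refine le_trans (Finset.sum_le_sum fun k hk => ?_)
      (Finset.sum_le_sum_of_subset (Finset.subset_univ F))
    rw [Set.indicator_of_mem (hF k hk)]
    simp
  have h3 : (F.card * l : ℤ) ≤ Finsupp.weight ((varsIn P).indicator (1 : Fin r → ℕ)) c := by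
    exact_mod_cast h1.trans h2
  linarith [mul_comm (F.card : ℤ) l]

end NegativePart

/-! ### Vanishing of the cohomology in negative degrees -/

section Tameness

variable {K : Type*} [Field K]

/-- The map `C^t → C^t` given by additive endomorphisms of the localizations `R_{y_F}`. -/
def mapCochain {R : Type*} [CommRing R] {r : ℕ} {y : Fin r → R}
    (f : (F : Finset (Fin r)) → Loc y F →+ Loc y F) (W : Set (Fin r)) (t : ℕ) :
    Cochain y W t →+ Cochain y W t :=
  AddMonoidHom.pi fun F : Face W t => (f F.1).comp (Pi.evalAddMonoidHom _ F)

theorem mapCochain_apply {R : Type*} [CommRing R] {r : ℕ} {y : Fin r → R}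
    (f : (F : Finset (Fin r)) → Loc y F →+ Loc y F) (W : Set (Fin r)) (t : ℕ)
    (c : Cochain y W t) (F : Face W t) : mapCochain f W t c F = f F.1 (c F) := rfl

/-- Additive maps that commute with the natural maps between the localizations form a chain map. -/
theorem differential_mapCochain {R : Type*} [CommRing R] {r : ℕ} {y : Fin r → R}
    {f : (F : Finset (Fin r)) → Loc y F →+ Loc y F}
    (hf : ∀ (F G : Finset (Fin r)) (h : F ⊆ G) (z : Loc y F),
      natMap y h (f F z) = f G (natMap y h z))
    (W : Set (Fin r)) (t : ℕ) (c : Cochain y W t) :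
    differential y W t (mapCochain f W t c) = mapCochain f W (t + 1) (differential y W t c) := by
  funext G
  rw [mapCochain_apply, differential_apply, differential_apply, map_sum]
  refine Finset.sum_congr rfl fun k _ => ?_
  rw [mapCochain_apply, hf (G.erase k).1 G.1]
  rcases neg_one_pow_eq_or R (G.1.filter (· < k.1)).card with h | h
  · rw [h, one_smul, one_smul]
  · rw [h, neg_one_smul, neg_one_smul, map_neg]

theorem mapCochain_mem_coboundaries {R : Type*} [CommRing R] {r : ℕ} {y : Fin r → R}
    {f : (F : Finset (Fin r)) → Loc y F →+ Loc y F}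
    (hf : ∀ (F G : Finset (Fin r)) (h : F ⊆ G) (z : Loc y F),
      natMap y h (f F z) = f G (natMap y h z))
    (W : Set (Fin r)) (i : ℕ) {c : Cochain y W i} (hc : c ∈ coboundaries y W i) :
    mapCochain f W i c ∈ coboundaries y W i := by
  cases i with
  | zero =>
    have h : c = 0 := hc
    rw [h, map_zero]
    exact zero_mem _
  | succ i =>
    obtain ⟨b, rfl⟩ := hc
    exact ⟨_, differential_mapCochain hf W i b⟩

theorem cohomologyDegree_eq_bot_iff {R : Type*} [CommRing R] [Algebra K R] {r : ℕ}
    (𝒜 : ℕ → Submodule K R) (y : Fin r → R) (W : Set (Fin r)) (i : ℕ) (j : ℤ) :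
    cohomologyDegree 𝒜 y W i j = ⊥ ↔
      ∀ c ∈ cochainDegree 𝒜 y W i j, differential y W i c = 0 → c ∈ coboundaries y W i := by
  rw [cohomologyDegree, eq_bot_iff, Submodule.map_le_iff_le_comap]
  constructor
  · intro h c hc hd
    have h1 := h (show (⟨c, hd⟩ : cocycles y W i) ∈ _ from hc)
    have h2 := (Submodule.mem_bot K).1 (Submodule.mem_comap.1 h1)
    have h3 := (Submodule.Quotient.mk_eq_zero
      ((coboundaries y W i).comap (cocycles y W i).subtype)).1 h2
    exact h3
  · rintro h ⟨c, hd⟩ hc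
    exact (Submodule.mem_bot K).2 ((Submodule.Quotient.mk_eq_zero _).2 (h c hc hd))

variable {r : ℕ} {I : Ideal (MvPolynomial (Fin r) K)} (P : Ideal (MvPolynomial (Fin r) K ⧸ I))

/-- If every cocycle of degree `j - 1` is a coboundary, then so is `π_k c = y_k • (c / y_k)` for
every cocycle `c` of degree `j`, where `π_k` is the projection onto the part of negative degree in
`y_k`, and `c / y_k` is formed on that part. -/
theorem negDegPart_mem_coboundaries (hI : IsSquarefreeMonomialIdeal I) {i : ℕ} {j : ℤ}
    (h : localCohomologyDegree P i (j - 1) = ⊥) (k : Fin r)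
    {c : Cochain (resVar I) (varsIn P) i}
    (hc : c ∈ cochainDegree (ringDegree P) (resVar I) (varsIn P) i j)
    (hd : differential (resVar I) (varsIn P) i c = 0) :
    mapCochain (fun F => (negDegPart hI k F).toAddMonoidHom) (varsIn P) i c ∈
      coboundaries (resVar I) (varsIn P) i := by
  rw [localCohomologyDegree, cohomologyDegree_eq_bot_iff] at h
  have h1 : mapCochain (fun F => (negDiv hI k F).toAddMonoidHom) (varsIn P) i c ∈
      coboundaries (resVar I) (varsIn P) i := by
    refine h _ (fun F _ => negDiv_mem_locDegree hI P F.2.1 k (hc F trivial)) ?_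
    have hf : ∀ (F G : Finset (Fin r)) (h : F ⊆ G) (z : Loc (resVar I) F),
        natMap (resVar I) h ((negDiv hI k F).toAddMonoidHom z) =
          (negDiv hI k G).toAddMonoidHom (natMap (resVar I) h z) :=
      fun F G h z => natMap_negDiv hI k h z
    exact (differential_mapCochain hf (varsIn P) i c).trans (by rw [hd, map_zero])
  have h2 := Submodule.smul_mem _ (resVar I k) h1
  have h3 : resVar I k • mapCochain (fun F => (negDiv hI k F).toAddMonoidHom) (varsIn P) i c =
      mapCochain (fun F => (negDegPart hI k F).toAddMonoidHom) (varsIn P) i c :=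
    funext fun F => resVar_smul_negDiv hI k F.1 (c F)
  rwa [h3] at h2

/-- Vanishing in degree `j - 1` forces vanishing in the negative degree `j`: modulo coboundaries, a
cocycle of degree `j` equals its image under the product of the `1 - π_k`, which is zero. -/
theorem localCohomologyDegree_eq_bot (hI : IsSquarefreeMonomialIdeal I) {i : ℕ} {j : ℤ}
    (hj : j < 0) (h : localCohomologyDegree P i (j - 1) = ⊥) : localCohomologyDegree P i j = ⊥ := by
  rw [localCohomologyDegree, cohomologyDegree_eq_bot_iff]
  intro c hc hd
  have key : ∀ L : List (Fin r),
      c - mapCochain (fun F => (nonnegDegPart hI L F).toAddMonoidHom) (varsIn P) i c ∈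
        coboundaries (resVar I) (varsIn P) i := by
    intro L
    induction L with
    | nil =>
      have h0 : mapCochain (fun F => (nonnegDegPart hI [] F).toAddMonoidHom) (varsIn P) i c = c :=
        rfl
      rw [h0, sub_self]
      exact zero_mem _
    | cons k L ih =>
      have h1 := mapCochain_mem_coboundaries (fun F G => natMap_negDegPart hI k) (varsIn P) i ih
        (f := fun F => (negDegPart hI k F).toAddMonoidHom)
      have h2 := negDegPart_mem_coboundaries P hI h k hc hd
      rw [map_sub] at h1
      have h3 : mapCochain (fun F => (nonnegDegPart hI (k :: L) F).toAddMonoidHom) (varsIn P) i c =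
          mapCochain (fun F => (nonnegDegPart hI L F).toAddMonoidHom) (varsIn P) i c -
            mapCochain (fun F => (negDegPart hI k F).toAddMonoidHom) (varsIn P) i
              (mapCochain (fun F => (nonnegDegPart hI L F).toAddMonoidHom) (varsIn P) i c) :=
        funext fun F => nonnegDegPart_cons hI k L F.1 (c F)
      rw [h3]
      convert add_mem ih (sub_mem h2 h1) using 1
      abel
  have h0 : mapCochain (fun F => (nonnegDegPart hI (List.finRange r) F).toAddMonoidHom)
      (varsIn P) i c = 0 :=
    funext fun F => nonnegDegPart_eq_zero hI P F.2.1 (fun k _ => List.mem_finRange k) hj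
      (hc F trivial)
  have := key (List.finRange r)
  rwa [h0, sub_zero] at this

end Tameness

theorem mainTheorem6 {K : Type*} [Field K] {r : ℕ} (I : Ideal (MvPolynomial (Fin r) K))
    (hI : IsSquarefreeMonomialIdeal I) (P : Ideal (MvPolynomial (Fin r) K ⧸ I))
    (hmon : IsMonomialIdeal P) (hprime : P.IsPrime) (i : ℕ) :
    IsTame (fun j : ℤ => localCohomologyDegree P i j) := by
  by_cases h : ∀ j < 0, localCohomologyDegree P i j = ⊥
  · exact ⟨-1, Or.inl fun j hj => h j (by lia)⟩
  · push Not at h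
    obtain ⟨j₀, hj₀, hne⟩ := h
    refine ⟨j₀, Or.inr fun j hj => ?_⟩
    induction j, hj using Int.leInductionDown with
    | base => exact hne
    | pred j hj ih => exact fun h => ih (localCohomologyDegree_eq_bot P hI (by lia) h)
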